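/- **Corollary 1.2.** Let $k$ be a field and let $A=\bigoplus_{n\ge 0}A_n$ be a commutative standard graded $k$-algebra, i.e. $A_0=k$ and $A$ is generated as a $k$-algebra by finitely many elements of degree $1$. Let $d$ be the Krull dimension of $A$ and let the Hilbert series of $A$ be written as $$\mathrm{Hilb}(A,t)=\sum_{n\ge 0}\dim_k(A_n)\,t^n=\frac{h_0+h_1t+\cdots+h_st^s}{(1-t)^d},\qquad s\ge 0,\ h_0,\dots,h_s\in\mathbb Z .$$ For $r\ge 1$ let $A^{\langle r\rangle}=\bigoplus_{n\ge 0}A_{nr}$ be the $r$-th Veronese algebra of $A$, graded so that $A_{nr}$ is its component of degree $n$. For $r,d\in\mathbb N$ and $i\in\mathbb Z$ let $C(r,d,i)$ be the number of tuples $(a_1,\dots,a_d)\in\mathbb N^d$ with $a_1+\cdots+a_d=i$ and $a_j\le r$ for $1\le j\le d$ (so $C(r,0,i)=\delta_{0,i}$, and $C(r,d,i)=0$ for $i<0$). Then for every integer $r\ge 1$ $$\mathrm{Hilb}(A^{\langle r\rangle},t)=\frac{h_0^{\langle r\rangle}+h_1^{\langle r\rangle}t+\cdots+h_m^{\langle r\rangle}t^m}{(1-t)^d},$$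 where $m=\max(s,d)$ and $$h_i^{\langle r\rangle}=\sum_{j=0}^{s}C(r-1,d,ir-j)\,h_j\qquad\text{for } i=0,\dots,m .$$ -/

import Mathlib

/-- A grading `A = ⨁ₙ 𝒜 n` of a `k`-algebra makes it a standard graded `k`-algebra when `𝒜 0 = k`
(that is, `k → A` is injective with image `𝒜 0`) and `A` is generated as a `k`-algebra by finitely
many elements of degree `1`. -/
structure IsStandardGraded {k A : Type*} [Field k] [CommRing A] [Algebra k A]
    (𝒜 : ℕ → Submodule k A) [GradedAlgebra 𝒜] : Prop where
  injective_algebraMap : Function.Injective (algebraMap k A)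
  degree_zero : (𝒜 0 : Set A) = Set.range (algebraMap k A)
  generated : ∃ S : Set A, S.Finite ∧ S ⊆ 𝒜 1 ∧ Algebra.adjoin k S = ⊤

/-- The Hilbert series `∑ₙ (dim_k 𝒜 n) Xⁿ`. It is meant for gradings whose components are
finite-dimensional, as they are for a standard graded algebra and for its Veronese algebras. -/
noncomputable def hilbertSeries {k A : Type*} [Field k] [CommRing A] [Algebra k A]
    (𝒜 : ℕ → Submodule k A) : PowerSeries ℤ :=
  PowerSeries.mk fun n => (Module.finrank k (𝒜 n) : ℤ)

/-- The `r`-th Veronese algebra `⨁ₙ 𝒜 (n * r)`, as a subalgebra of `A`. -/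
def veronese {k A : Type*} [Field k] [CommRing A] [Algebra k A]
    (𝒜 : ℕ → Submodule k A) [GradedAlgebra 𝒜] (r : ℕ) : Subalgebra k A :=
  Submodule.toSubalgebra (⨆ n, 𝒜 (n * r))
    (Submodule.mem_iSup_of_mem 0 (by
      rw [Nat.zero_mul]
      exact SetLike.GradedOne.one_mem))
    (fun x y hx hy => by
      refine Submodule.iSup_induction _ (motive := fun x => x * y ∈ ⨆ n, 𝒜 (n * r)) hx ?_ ?_ ?_
      · intro i a ha
        refine Submodule.iSup_induction _ (motive := fun y => a * y ∈ ⨆ n, 𝒜 (n * r)) hy ?_ ?_ ?_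
        · intro j b hb
          refine Submodule.mem_iSup_of_mem (i + j) ?_
          rw [Nat.add_mul]
          exact SetLike.GradedMul.mul_mem ha hb
        · simp
        · intro b c hb hc
          rw [mul_add]
          exact add_mem hb hc
      · simp
      · intro b c hb hc
        rw [add_mul]
        exact add_mem hb hc)

/-- The grading of the `r`-th Veronese algebra: its component of degree `n` is `𝒜 (n * r)`. -/
def veroneseGrading {k A : Type*} [Field k] [CommRing A] [Algebra k A]
    (𝒜 : ℕ → Submodule k A) [GradedAlgebra 𝒜] (r n : ℕ) : Submodule k (veronese 𝒜 r) :=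
  (𝒜 (n * r)).comap (veronese 𝒜 r).val.toLinearMap

/-- For `r ≥ 1` these components do form a grading of the Veronese algebra. -/
noncomputable instance veroneseGrading.gradedAlgebra {k A : Type*} [Field k] [CommRing A]
    [Algebra k A] (𝒜 : ℕ → Submodule k A) [GradedAlgebra 𝒜] (r : ℕ) [NeZero r] :
    GradedAlgebra (veroneseGrading 𝒜 r) where
  one_mem := by
    change (1 : A) ∈ 𝒜 (0 * r)
    rw [Nat.zero_mul]
    exact SetLike.GradedOne.one_mem
  mul_mem := by
    intro i j a b ha hb
    change (a : A) * (b : A) ∈ 𝒜 ((i + j) * r)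
    rw [Nat.add_mul]
    exact SetLike.GradedMul.mul_mem ha hb
  toDecomposition := by
    refine DirectSum.IsInternal.chooseDecomposition _ ?_
    rw [DirectSum.isInternal_submodule_iff_iSupIndep_and_iSup_eq_top]
    have hmap : ∀ n, (veroneseGrading 𝒜 r n).map (veronese 𝒜 r).val.toLinearMap
        = 𝒜 (n * r) := by
      intro n
      refine Submodule.map_comap_eq_of_le ?_
      intro x hx
      exact ⟨⟨x, Submodule.mem_iSup_of_mem (p := fun n => 𝒜 (n * r)) n hx⟩, rfl⟩
    have hinj : Function.Injective (veronese 𝒜 r).val.toLinearMap := Subtype.val_injective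
    constructor
    · have hind : iSupIndep fun n => 𝒜 (n * r) :=
        (DirectSum.Decomposition.isInternal 𝒜).submodule_iSupIndep.comp
          (mul_left_injective₀ (NeZero.ne r))
      intro i
      rw [Submodule.disjoint_def]
      intro x hx hx'
      refine hinj ?_
      rw [map_zero]
      refine Submodule.disjoint_def.mp (hind i) _ hx ?_
      have h2 := Submodule.mem_map_of_mem (f := (veronese 𝒜 r).val.toLinearMap) hx'
      simpa only [Submodule.map_iSup, hmap] using h2
    · refine Submodule.map_injective_of_injective hinj ?_
      rw [Submodule.map_iSup]
      simp only [hmap, Submodule.map_top]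
      ext x
      exact ⟨fun hx => ⟨⟨x, hx⟩, rfl⟩, fun ⟨y, hy⟩ => hy ▸ y.2⟩

/-- `boundedSumCount r d i` is the number of `(a₁, …, a_d) ∈ ℕ^d` with `a₁ + ⋯ + a_d = i` and
`a_j ≤ r` for all `j`, for an integer `i` (so it is `0` for `i < 0`, and for `d = 0` it is `1` if
`i = 0` and `0` otherwise). -/
def boundedSumCount (r d : ℕ) (i : ℤ) : ℕ :=
  ((Fintype.piFinset fun _ : Fin d => Finset.range (r + 1)).filter
    fun a => ((∑ j, a j : ℕ) : ℤ) = i).card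

/-! The Hilbert series of the Veronese algebra keeps every `r`-th coefficient of that of `A`, and
this operation turns a factor `1 - X ^ r` into a factor `1 - X`
(`PowerSeries.multisection_mul_one_sub_X_pow`). Since `1 / (1 - X) ^ d = (1 + ⋯ + X ^ (r - 1)) ^ d /
(1 - X ^ r) ^ d`, the new numerator is the multisection of `h(X) * (1 + ⋯ + X ^ (r - 1)) ^ d`, whose
coefficients count bounded tuples (`coeff_geom_sum_pow`). A degree estimate
(`boundedSumCount_veronese_eq_zero`) bounds its degree by `max s d`. -/

/-- The series `∑ₙ aₙᵣ Xⁿ` made of every `r`-th coefficient of `∑ₙ aₙ Xⁿ`. -/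
noncomputable def PowerSeries.multisection {R : Type*} [Semiring R] (r : ℕ) (F : PowerSeries R) :
    PowerSeries R :=
  PowerSeries.mk fun n => PowerSeries.coeff (n * r) F

/-- Multiplication by `X ^ r` moves index `n * r` to `(n + 1) * r`, which is a shift by one after
multisection. -/
theorem PowerSeries.multisection_mul_one_sub_X_pow {R : Type*} [CommRing R] {r : ℕ} (hr : 1 ≤ r)
    (F : PowerSeries R) :
    multisection r (F * (1 - X ^ r)) = multisection r F * (1 - X) := by
  ext n
  cases n with
  | zero =>
    simp [multisection, mul_sub, coeff_mul_X_pow', Nat.pos_iff_ne_zero.mp hr]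
  | succ n =>
    simp [multisection, mul_sub, coeff_mul_X_pow', coeff_succ_mul_X, Nat.succ_mul]

theorem PowerSeries.multisection_mul_one_sub_X_pow_pow {R : Type*} [CommRing R] {r : ℕ}
    (hr : 1 ≤ r) (F : PowerSeries R) (d : ℕ) :
    multisection r (F * (1 - X ^ r) ^ d) = multisection r F * (1 - X) ^ d := by
  induction d with
  | zero => simp
  | succ d ih =>
    rw [pow_succ, ← mul_assoc, multisection_mul_one_sub_X_pow hr, ih, pow_succ, mul_assoc]

/-- Expanding the `d`-th power gives one monomial `X ^ (a₁ + ⋯ + a_d)` per tuple with entries at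
most `r`. -/
theorem coeff_geom_sum_pow {R : Type*} [CommRing R] (r d i : ℕ) :
    PowerSeries.coeff i ((∑ l ∈ Finset.range (r + 1), (PowerSeries.X : PowerSeries R) ^ l) ^ d) =
      (boundedSumCount r d i : R) := by
  have hprod : (∑ l ∈ Finset.range (r + 1), (PowerSeries.X : PowerSeries R) ^ l) ^ d =
      ∑ a ∈ Fintype.piFinset fun _ : Fin d => Finset.range (r + 1),
        PowerSeries.X ^ (∑ j, a j) := by
    simp_rw [← Finset.prod_pow_eq_pow_sum, ← Finset.prod_univ_sum]
    simp
  rw [hprod, map_sum, boundedSumCount, Finset.card_filter, Nat.cast_sum]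
  refine Finset.sum_congr rfl fun a _ => ?_
  rw [PowerSeries.coeff_X_pow]
  simp only [Nat.cast_inj, eq_comm (a := i)]
  split_ifs <;> simp

theorem boundedSumCount_eq_zero_of_neg {r d : ℕ} {i : ℤ} (hi : i < 0) :
    boundedSumCount r d i = 0 := by
  rw [boundedSumCount, Finset.card_eq_zero, Finset.filter_eq_empty_iff]
  intro a _ ha
  omega

theorem boundedSumCount_eq_zero_of_lt {r d : ℕ} {i : ℤ} (hi : (d * r : ℤ) < i) :
    boundedSumCount r d i = 0 := by
  rw [boundedSumCount, Finset.card_eq_zero, Finset.filter_eq_empty_iff]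
  intro a ha hsum
  have hle : ∑ j, a j ≤ d * r := by
    simpa using Finset.sum_le_card_nsmul Finset.univ a r fun j _ =>
      Nat.lt_succ_iff.mp (Finset.mem_range.mp (Fintype.mem_piFinset.mp ha j))
  have : ((∑ j, a j : ℕ) : ℤ) ≤ d * r := by exact_mod_cast hle
  omega

theorem coeff_X_pow_mul_geom_sum_pow {R : Type*} [CommRing R] (r d j n : ℕ) :
    PowerSeries.coeff n (PowerSeries.X ^ j *
        (∑ l ∈ Finset.range (r + 1), (PowerSeries.X : PowerSeries R) ^ l) ^ d) =
      (boundedSumCount r d ((n : ℤ) - j) : R) := by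
  rw [PowerSeries.coeff_X_pow_mul']
  split_ifs with hj
  · rw [coeff_geom_sum_pow, Nat.cast_sub hj]
  -- Here `n < j`: the integer `n - j` is negative, whereas truncated subtraction would give `0`.
  · rw [boundedSumCount_eq_zero_of_neg (by omega), Nat.cast_zero]

theorem boundedSumCount_veronese_eq_zero {r d s i j : ℕ} (hr : 1 ≤ r) (hi : max s d < i)
    (hj : j ≤ s) : boundedSumCount (r - 1) d ((i : ℤ) * r - j) = 0 := by
  apply boundedSumCount_eq_zero_of_lt
  obtain ⟨q, rfl⟩ := Nat.exists_eq_add_of_le' hr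
  obtain ⟨hs, hd⟩ := max_lt_iff.mp hi
  -- With `r = q + 1`, `i * r - j = i * q + (i - j)`, where `i * q ≥ d * q` as `i > d`, and `i - j >
  -- 0` as `i > s ≥ j`.
  have hmul : (d : ℤ) * q ≤ i * q := by gcongr
  push_cast [Nat.add_sub_cancel]
  rw [mul_add]
  omega

theorem multisection_sum_mul_geom_sum_pow {R : Type*} [CommRing R] {r : ℕ} (hr : 1 ≤ r)
    (d s : ℕ) (h : ℕ → R) :
    PowerSeries.multisection r
        ((∑ j ∈ Finset.range (s + 1), PowerSeries.C (h j) * PowerSeries.X ^ j) *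
          (∑ l ∈ Finset.range r, PowerSeries.X ^ l) ^ d) =
      ∑ i ∈ Finset.range (max s d + 1),
        PowerSeries.C (∑ j ∈ Finset.range (s + 1),
          (boundedSumCount (r - 1) d ((i : ℤ) * r - j) : R) * h j) * PowerSeries.X ^ i := by
  have hcoeff (n : ℕ) : PowerSeries.coeff (n * r)
      ((∑ j ∈ Finset.range (s + 1), PowerSeries.C (h j) * PowerSeries.X ^ j) *
          (∑ l ∈ Finset.range r, PowerSeries.X ^ l) ^ d) =
      ∑ j ∈ Finset.range (s + 1),
          (boundedSumCount (r - 1) d ((n : ℤ) * r - j) : R) * h j := by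
    obtain ⟨q, rfl⟩ := Nat.exists_eq_add_of_le' hr
    rw [Finset.sum_mul, map_sum]
    refine Finset.sum_congr rfl fun j _ => ?_
    rw [mul_assoc, PowerSeries.coeff_C_mul, coeff_X_pow_mul_geom_sum_pow, mul_comm,
      Nat.add_sub_cancel, Nat.cast_mul]
  ext n
  rw [PowerSeries.multisection, PowerSeries.coeff_mk, hcoeff, map_sum]
  simp only [PowerSeries.coeff_C_mul, PowerSeries.coeff_X_pow, mul_ite, mul_one,
    mul_zero, Finset.sum_ite_eq, Finset.mem_range]
  split_ifs with hn
  · rfl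
  · refine Finset.sum_eq_zero fun j hj => ?_
    rw [boundedSumCount_veronese_eq_zero hr (by omega)
      (Nat.lt_succ_iff.mp (Finset.mem_range.mp hj)), Nat.cast_zero, zero_mul]

theorem multisection_mul_invOneSubPow {R : Type*} [CommRing R] {r : ℕ} (hr : 1 ≤ r)
    (F : PowerSeries R) (d : ℕ) :
    PowerSeries.multisection r (F * (PowerSeries.invOneSubPow R d : PowerSeries R)) =
      PowerSeries.multisection r (F * (∑ l ∈ Finset.range r, PowerSeries.X ^ l) ^ d) *
        (PowerSeries.invOneSubPow R d : PowerSeries R) := by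
  have hinv : (PowerSeries.invOneSubPow R d : PowerSeries R) * (1 - PowerSeries.X) ^ d = 1 := by
    rw [← PowerSeries.invOneSubPow_inv_eq_one_sub_pow]
    exact (PowerSeries.invOneSubPow R d).val_inv
  have hgeom : F * (∑ l ∈ Finset.range r, PowerSeries.X ^ l) ^ d =
      F * (PowerSeries.invOneSubPow R d : PowerSeries R) * (1 - PowerSeries.X ^ r) ^ d := by
    -- Factor `1 - X ^ r = (1 - X) * (1 + ⋯ + X ^ (r - 1))`; the power of `1 - X` cancels against
    -- its inverse.
    rw [← mul_neg_geom_sum, mul_pow, mul_assoc, ← mul_assoc (PowerSeries.invOneSubPow R d).val,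
      hinv, one_mul]
  rw [hgeom, PowerSeries.multisection_mul_one_sub_X_pow_pow hr, mul_assoc,
    mul_comm ((1 - PowerSeries.X) ^ d), hinv, mul_one]

theorem finrank_veroneseGrading {k A : Type*} [Field k] [CommRing A] [Algebra k A]
    (𝒜 : ℕ → Submodule k A) [GradedAlgebra 𝒜] (r n : ℕ) :
    Module.finrank k (veroneseGrading 𝒜 r n) = Module.finrank k (𝒜 (n * r)) := by
  have hmap : (veroneseGrading 𝒜 r n).map (veronese 𝒜 r).val.toLinearMap = 𝒜 (n * r) :=
    Submodule.map_comap_eq_of_le fun x hx =>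
      ⟨⟨x, Submodule.mem_iSup_of_mem (p := fun n => 𝒜 (n * r)) n hx⟩, rfl⟩
  rw [← hmap]
  exact (Submodule.equivMapOfInjective (veronese 𝒜 r).val.toLinearMap Subtype.val_injective
    (veroneseGrading 𝒜 r n)).finrank_eq

theorem hilbertSeries_veroneseGrading {k A : Type*} [Field k] [CommRing A] [Algebra k A]
    (𝒜 : ℕ → Submodule k A) [GradedAlgebra 𝒜] (r : ℕ) :
    hilbertSeries (veroneseGrading 𝒜 r) = PowerSeries.multisection r (hilbertSeries 𝒜) := by
  ext n
  simp only [hilbertSeries, PowerSeries.multisection, PowerSeries.coeff_mk,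
    finrank_veroneseGrading]

theorem corollary1p2 {k A : Type*} [Field k] [CommRing A] [Algebra k A]
    (𝒜 : ℕ → Submodule k A) [GradedAlgebra 𝒜] (hA : IsStandardGraded 𝒜)
    (d : ℕ) (hd : ringKrullDim A = d) (s : ℕ) (h : ℕ → ℤ)
    (hh : hilbertSeries 𝒜 =
      (∑ j ∈ Finset.range (s + 1), PowerSeries.C (h j) * PowerSeries.X ^ j) *
        (PowerSeries.invOneSubPow ℤ d : PowerSeries ℤ))
    (r : ℕ) (hr : 1 ≤ r) :
    hilbertSeries (veroneseGrading 𝒜 r) =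
      (∑ i ∈ Finset.range (max s d + 1),
          PowerSeries.C (∑ j ∈ Finset.range (s + 1),
            (boundedSumCount (r - 1) d ((i : ℤ) * r - j) : ℤ) * h j) * PowerSeries.X ^ i) *
        (PowerSeries.invOneSubPow ℤ d : PowerSeries ℤ) := by
  rw [hilbertSeries_veroneseGrading, hh, multisection_mul_invOneSubPow hr,
    multisection_sum_mul_geom_sum_pow hr]
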